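/- **Theorem 4.1 (Poincaré inequality for integrable kernels with compact support).** Let $d\ge 1$, let $\nu\in\mathbb R^d$ be a unit vector, and let $\chi_\nu$ be the characteristic function of $\{z\in\mathbb R^d: z\cdot\nu\ge 0\}$. Let $w:\mathbb R^d\to[0,\infty)$ be a radial kernel with $w\in L^1_{\rm loc}(\mathbb R^d\setminus\{0\})$ and $\int_{\mathbb R^d}\min(1,|x|)\,w(x)\,dx<\infty$, such that for some $\epsilon_0\in(0,1)$ one has $w(x)>0$ whenever $0<|x|\le\epsilon_0$. For $u:\mathbb R^d\to\mathbb R$ and $v:\mathbb R^d\to\mathbb R^d$ define the half-ball gradient and divergence $$\mathcal G_w^\nu u(x)=\lim_{\epsilon\to0^+}\int_{\mathbb R^d\setminus B_\epsilon(x)}\chi_\nu(y-x)\,\frac{y-x}{|y-x|}\,(u(y)-u(x))\,w(y-x)\,dy,$$ $$\mathcal D_w^{\nu} v(x)=\lim_{\epsilon\to0^+}\int_{\mathbb R^d\setminus B_\epsilon(x)}\chi_\nu(y-x)\,\frac{y-x}{|y-x|}\cdot(v(y)-v(x))\,w(y-x)\,dy .$$ For $u\in L^2(\mathbb R^d)$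 the distributional half-ball gradient $\mathfrak G_w^\nu u$ is defined by $\langle\mathfrak G_w^\nu u,\phi\rangle=-\int_{\mathbb R^d}u\,\mathcal D_w^{-\nu}\phi\,dx$ for $\phi\in C_c^\infty(\mathbb R^d;\mathbb R^d)$. For a domain (nonempty connected open set) $\Omega\subset\mathbb R^d$ let $$\mathcal S_w^\nu(\Omega)=\{u\in L^2(\mathbb R^d): u=0\text{ a.e. on }\mathbb R^d\setminus\Omega,\ \mathfrak G_w^\nu u\in L^2(\mathbb R^d;\mathbb R^d)\}.$$ Assume that $\Omega$ is bounded, that $w\in L^1(\mathbb R^d)$, and that $w$ vanishes a.e. outside some compact set. Then $\mathcal S_w^\nu(\Omega)=\{u\in L^2(\mathbb R^d):u=0\text{ a.e. on }\mathbb R^d\setminus\Omega\}$, and there is a constant $\Pi=\Pi(w,\Omega,\nu)>0$ such that $$\|u\|_{L^2(\Omega)}\le \Pi\,\|\mathfrak G_w^\nu u\|_{L^2(\mathbb R^d;\mathbb R^d)}\qquad\text{for all }u\in\mathcal S_w^\nu(\Omega).$$ Moreover, for every $u\in\mathcal S_w^\nu(\Omega)$ the principal value $\mathcal G_w^\nu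 u(x)$ exists for a.e. $x$, and $\mathfrak G_w^\nu u=\mathcal G_w^\nu u\in L^2(\mathbb R^d;\mathbb R^d)$. -/

import Mathlib

open MeasureTheory Filter Topology
open scoped ContDiff

/-- Standing assumptions on a kernel `w` on `ℝ^d`: locally integrable away from the origin,
nonnegative, radial, positive on a punctured ball, and `min(1,|x|) w(x)` is integrable. -/
structure IsHalfBallKernel {d : ℕ} (w : EuclideanSpace ℝ (Fin d) → ℝ) : Prop where
  locallyIntegrableOn : LocallyIntegrableOn w {0}ᶜ volume
  nonneg : ∀ x, 0 ≤ w x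
  radial : ∀ x y, ‖x‖ = ‖y‖ → w x = w y
  pos_near_zero : ∃ ε₀ : ℝ, 0 < ε₀ ∧ ε₀ < 1 ∧ ∀ x, 0 < ‖x‖ → ‖x‖ ≤ ε₀ → 0 < w x
  integrable_min : Integrable (fun x => min 1 ‖x‖ * w x) volume

/-- The characteristic function of the closed half-space `{z : z · ν ≥ 0}`. -/
noncomputable def halfSpaceChar {d : ℕ} (ν z : EuclideanSpace ℝ (Fin d)) : ℝ :=
  Set.indicator {z' : EuclideanSpace ℝ (Fin d) | 0 ≤ inner ℝ z' ν} (fun _ => (1 : ℝ)) z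

/-- The integrand `χ_ν(y-x) (y-x)/|y-x| (u(y)-u(x)) w(y-x)` of the half-ball gradient of a
scalar function. -/
noncomputable def halfBallGradIntegrand {d : ℕ} (w : EuclideanSpace ℝ (Fin d) → ℝ)
    (ν : EuclideanSpace ℝ (Fin d)) (u : EuclideanSpace ℝ (Fin d) → ℝ)
    (x y : EuclideanSpace ℝ (Fin d)) : EuclideanSpace ℝ (Fin d) :=
  (halfSpaceChar ν (y - x) * (u y - u x) * w (y - x)) • (‖y - x‖⁻¹ • (y - x))

/-- The integrand `χ_ν(y-x) (y-x)/|y-x| · (v(y)-v(x)) w(y-x)` of the half-ball divergence of a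
vector field. -/
noncomputable def halfBallDivIntegrand {d : ℕ} (w : EuclideanSpace ℝ (Fin d) → ℝ)
    (ν : EuclideanSpace ℝ (Fin d)) (v : EuclideanSpace ℝ (Fin d) → EuclideanSpace ℝ (Fin d))
    (x y : EuclideanSpace ℝ (Fin d)) : ℝ :=
  halfSpaceChar ν (y - x) * inner ℝ (‖y - x‖⁻¹ • (y - x)) (v y - v x) * w (y - x)

/-- The principal value integral defining the half-ball gradient of `u` at `x` exists and equals
`G`: the integrals over the complements of the balls `B_ε(x)` converge absolutely, and tend to
`G` as `ε → 0+`. -/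
def HasHalfBallGradAt {d : ℕ} (w : EuclideanSpace ℝ (Fin d) → ℝ)
    (ν : EuclideanSpace ℝ (Fin d)) (u : EuclideanSpace ℝ (Fin d) → ℝ)
    (x G : EuclideanSpace ℝ (Fin d)) : Prop :=
  (∀ ε : ℝ, 0 < ε →
    IntegrableOn (halfBallGradIntegrand w ν u x) (Metric.ball x ε)ᶜ volume) ∧
  Tendsto (fun ε : ℝ => ∫ y in (Metric.ball x ε)ᶜ, halfBallGradIntegrand w ν u x y)
    (𝓝[>] 0) (𝓝 G)

/-- The nonlocal half-ball gradient of `u`, as a principal value. -/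
noncomputable def halfBallGrad {d : ℕ} (w : EuclideanSpace ℝ (Fin d) → ℝ)
    (ν : EuclideanSpace ℝ (Fin d)) (u : EuclideanSpace ℝ (Fin d) → ℝ)
    (x : EuclideanSpace ℝ (Fin d)) : EuclideanSpace ℝ (Fin d) :=
  limUnder (𝓝[>] (0 : ℝ))
    (fun ε : ℝ => ∫ y in (Metric.ball x ε)ᶜ, halfBallGradIntegrand w ν u x y)

/-- The nonlocal half-ball divergence of `v`, as a principal value. -/
noncomputable def halfBallDiv {d : ℕ} (w : EuclideanSpace ℝ (Fin d) → ℝ)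
    (ν : EuclideanSpace ℝ (Fin d)) (v : EuclideanSpace ℝ (Fin d) → EuclideanSpace ℝ (Fin d))
    (x : EuclideanSpace ℝ (Fin d)) : ℝ :=
  limUnder (𝓝[>] (0 : ℝ))
    (fun ε : ℝ => ∫ y in (Metric.ball x ε)ᶜ, halfBallDivIntegrand w ν v x y)

/-- The distributional half-ball gradient of `u` as a functional of the vector field `φ`:
minus the pairing of `u` with the half-ball divergence of `φ` in direction `-ν`.
It is only used for smooth, compactly supported `φ`. -/
noncomputable def distHalfBallGrad {d : ℕ} (w : EuclideanSpace ℝ (Fin d) → ℝ)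
    (ν : EuclideanSpace ℝ (Fin d)) (u : EuclideanSpace ℝ (Fin d) → ℝ)
    (φ : EuclideanSpace ℝ (Fin d) → EuclideanSpace ℝ (Fin d)) : ℝ :=
  -∫ x, u x * halfBallDiv w (-ν) φ x

/-- The distributional half-ball gradient of `u` is (represented by) the `L²` vector field `g`. -/
def IsL2DistHalfBallGrad {d : ℕ} (w : EuclideanSpace ℝ (Fin d) → ℝ)
    (ν : EuclideanSpace ℝ (Fin d)) (u : EuclideanSpace ℝ (Fin d) → ℝ)
    (g : EuclideanSpace ℝ (Fin d) → EuclideanSpace ℝ (Fin d)) : Prop :=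
  MemLp g 2 volume ∧
  ∀ φ : EuclideanSpace ℝ (Fin d) → EuclideanSpace ℝ (Fin d),
    ContDiff ℝ ∞ φ → HasCompactSupport φ →
      distHalfBallGrad w ν u φ = ∫ x, inner ℝ (g x) (φ x)

/-- The energy space: `L²` functions on `ℝ^d` that vanish a.e. outside `Ω` and whose
distributional half-ball gradient is in `L²`. -/
def halfBallEnergySpace {d : ℕ} (w : EuclideanSpace ℝ (Fin d) → ℝ)
    (ν : EuclideanSpace ℝ (Fin d)) (Ω : Set (EuclideanSpace ℝ (Fin d))) :
    Set (EuclideanSpace ℝ (Fin d) → ℝ) :=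
  {u | MemLp u 2 volume ∧ (∀ᵐ x ∂volume, x ∉ Ω → u x = 0) ∧
    ∃ g, IsL2DistHalfBallGrad w ν u g}

/-!
For an integrable kernel no cancellation is needed: with `K(z) = χ_ν(z) w(z) z/|z|`, which is
integrable, the half-ball gradient of `u ∈ L²` is the averaged increment
`G u(x) = ∫ (u(x + z) - u(x)) K(z) dz`. The integrand is absolutely integrable for almost every `x`,
so the principal value exists (`ae_hasHalfBallGradAt`), and a weighted Cauchy–Schwarz inequality
gives `G u ∈ L²` (`memLp_integral_sub_smul`). Fubini and translation invariance identify `G u` with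
the distributional gradient (`isL2DistHalfBallGrad_halfBallGrad`); radiality of `w` enters through
`K_{-ν}(z) = -K_ν(-z)`. Hence the energy space contains every
`L²` function vanishing outside `Ω`.

The Poincaré inequality uses only the component of `G u` along `ν`, whose scalar kernel
`k = K · ν` is nonnegative. Since `a (b - a) = (b² - a²)/2 - (b - a)²/2` and the term `b² - a²`
integrates to zero by translation invariance, there is the energy identity
(`integral_mul_integral_sub_mul`)

  `-∫ u (G u · ν) = (1/2) ∫ k(z) ‖u(· + z) - u‖² dz`.

The right-hand side is coercive on functions supported in the bounded set `Ω`
(`setIntegral_mul_integral_sq_le`): `‖u(· + n z) - u‖ ≤ n ‖u(· + z) - u‖` by the triangle inequality,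
and once `n |z|` exceeds the diameter of `Ω` the two terms on the left have disjoint supports, so
that `‖u‖ ≤ n ‖u(· + z) - u‖`. One `n` serves all `z` in an annulus on which `w` is positive, and
`k` has positive mass there (`setIntegral_annulus_pos`). Young's inequality for the left-hand side
then bounds `‖u‖` by a multiple of `‖G u‖`. The same bound for any representative of the
distributional gradient follows from its uniqueness (`IsL2DistHalfBallGrad.ae_eq`).
-/

/-! ### Weighted Cauchy–Schwarz inequalities -/

/-- Cauchy–Schwarz for the weight `k`. -/
lemma sq_integral_mul_le {α : Type*} [MeasurableSpace α] {μ : Measure α} {a k : α → ℝ}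
    (hk0 : ∀ z, 0 ≤ k z) (hk : Integrable k μ)
    (hak : Integrable (fun z => a z * k z) μ) (ha2k : Integrable (fun z => a z ^ 2 * k z) μ) :
    (∫ z, a z * k z ∂μ) ^ 2 ≤ (∫ z, k z ∂μ) * ∫ z, a z ^ 2 * k z ∂μ := by
  have h := discrim_le_zero (a := ∫ z, k z ∂μ) (b := 2 * ∫ z, a z * k z ∂μ)
    (c := ∫ z, a z ^ 2 * k z ∂μ) fun t => ?_
  · unfold discrim at h
    nlinarith
  · have h0 : 0 ≤ ∫ z, (a z + t) ^ 2 * k z ∂μ :=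
      integral_nonneg fun z => mul_nonneg (sq_nonneg _) (hk0 z)
    have h1 : ∫ z, (a z + t) ^ 2 * k z ∂μ
        = ∫ z, (t * t) * k z + (2 * t) * (a z * k z) + a z ^ 2 * k z ∂μ :=
      integral_congr_ae (ae_of_all _ fun z => by ring)
    have hA := hk.const_mul (t * t)
    have hB := hak.const_mul (2 * t)
    have hAB : Integrable (fun z => (t * t) * k z + (2 * t) * (a z * k z)) μ := hA.add hB
    rw [h1, integral_add hAB ha2k, integral_add hA hB, integral_const_mul,
      integral_const_mul] at h0
    linarith

/-- If `v²‖K‖`, `K` and `‖φ‖²` are integrable, then so is `v(x, z) ⟪K z, φ x⟫` on the product space,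
since `|v| ‖K‖ ‖φ‖ ≤ (v² + ‖φ‖²) ‖K‖`. -/
lemma integrable_mul_inner_of_sq {α β F : Type*} [MeasurableSpace α] [MeasurableSpace β]
    [NormedAddCommGroup F] [InnerProductSpace ℝ F] {μ : Measure α} {ν : Measure β} [SFinite μ]
    [SFinite ν] {v : α × β → ℝ} {K : β → F} {φ : α → F}
    (hv : AEStronglyMeasurable v (μ.prod ν))
    (hv2 : Integrable (fun p : α × β => v p ^ 2 * ‖K p.2‖) (μ.prod ν))
    (hK : Integrable K ν) (hφ : MemLp φ 2 μ) :
    Integrable (fun p : α × β => v p * inner ℝ (K p.2) (φ p.1)) (μ.prod ν) := by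
  have h := hv2.add (Integrable.mul_prod hφ.norm.integrable_sq hK.norm)
  refine h.mono' (hv.mul (hK.1.comp_snd.inner hφ.1.comp_fst)) (ae_of_all _ fun p => ?_)
  simp only [Pi.add_apply, norm_mul, Real.norm_eq_abs]
  have h1 := abs_real_inner_le_norm (K p.2) (φ p.1)
  have h2 := mul_le_mul_of_nonneg_left h1 (abs_nonneg (v p))
  have h3 := norm_nonneg (K p.2)
  nlinarith [mul_nonneg (sq_nonneg (|v p| - ‖φ p.1‖)) h3,
    mul_nonneg (sq_nonneg (|v p| + ‖φ p.1‖)) h3, sq_abs (v p)]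

lemma integrable_mul_inner {α β F : Type*} [MeasurableSpace α] [MeasurableSpace β]
    [NormedAddCommGroup F] [InnerProductSpace ℝ F] {μ : Measure α} {ν : Measure β} [SFinite μ]
    [SFinite ν] {u : α → ℝ} {K : β → F} {φ : α → F} (hu : MemLp u 2 μ)
    (hK : Integrable K ν) (hφ : MemLp φ 2 μ) :
    Integrable (fun p : α × β => u p.1 * inner ℝ (K p.2) (φ p.1)) (μ.prod ν) :=
  integrable_mul_inner_of_sq hu.1.comp_fst (Integrable.mul_prod hu.integrable_sq hK.norm) hK hφ

/-! ### Averaged increments against an integrable kernel -/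

section Increments

variable {E F : Type*} [NormedAddCommGroup E] [NormedSpace ℝ E] [FiniteDimensional ℝ E]
  [MeasurableSpace E] [BorelSpace E] [NormedAddCommGroup F] [InnerProductSpace ℝ F]
  {μ : Measure E} [μ.IsAddHaarMeasure]

lemma aestronglyMeasurable_comp_fst_add_snd {G : Type*} [TopologicalSpace G] {u : E → G}
    (hu : AEStronglyMeasurable u μ) :
    AEStronglyMeasurable (fun p : E × E => u (p.1 + p.2)) (μ.prod μ) :=
  hu.comp_quasiMeasurePreserving (quasiMeasurePreserving_add μ μ)

lemma aestronglyMeasurable_sub_smul {u : E → ℝ} {K : E → F}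
    (hu : AEStronglyMeasurable u μ) (hK : AEStronglyMeasurable K μ) :
    AEStronglyMeasurable (fun p : E × E => (u (p.1 + p.2) - u p.1) • K p.2) (μ.prod μ) :=
  ((aestronglyMeasurable_comp_fst_add_snd hu).sub hu.comp_fst).smul hK.comp_snd

lemma integrable_translate_sq_mul {u k : E → ℝ} (hu : MemLp u 2 μ) (hk : Integrable k μ) :
    Integrable (fun p : E × E => u (p.1 + p.2) ^ 2 * k p.2) (μ.prod μ) := by
  have h := Integrable.mul_prod hu.integrable_sq hk
  exact ((measurePreserving_add_prod μ μ).integrable_comp h.aestronglyMeasurable).2 h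

lemma integrable_sub_sq_mul {u k : E → ℝ} (hu : MemLp u 2 μ) (hk : Integrable k μ) :
    Integrable (fun p : E × E => (u (p.1 + p.2) - u p.1) ^ 2 * k p.2) (μ.prod μ) := by
  have h := ((integrable_translate_sq_mul hu hk.norm).add
    (Integrable.mul_prod hu.integrable_sq hk.norm)).const_mul 2
  refine h.mono' ((((aestronglyMeasurable_comp_fst_add_snd hu.1).sub hu.1.comp_fst).pow 2).mul
    hk.1.comp_snd) (ae_of_all _ fun p => ?_)
  simp only [Pi.add_apply, norm_mul, norm_pow, Real.norm_eq_abs, sq_abs]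
  have := abs_nonneg (k p.2)
  nlinarith [mul_nonneg (sq_nonneg (u (p.1 + p.2) + u p.1)) this]

lemma integrable_translate_mul_inner {u : E → ℝ} {K φ : E → F} (hu : MemLp u 2 μ)
    (hK : Integrable K μ) (hφ : MemLp φ 2 μ) :
    Integrable (fun p : E × E => u (p.1 + p.2) * inner ℝ (K p.2) (φ p.1)) (μ.prod μ) :=
  integrable_mul_inner_of_sq (aestronglyMeasurable_comp_fst_add_snd hu.1)
    (integrable_translate_sq_mul hu hK.norm) hK hφ

/-- For almost every `x` the increment of a square integrable function is integrable against an
integrable kernel. -/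
lemma ae_integrable_sub_smul {u : E → ℝ} {K : E → F} (hu : MemLp u 2 μ) (hK : Integrable K μ) :
    ∀ᵐ x ∂μ, Integrable (fun z => (u (x + z) - u x) • K z) μ := by
  filter_upwards [(integrable_sub_sq_mul hu hK.norm).prod_right_ae,
    (aestronglyMeasurable_sub_smul hu.1 hK.1).prodMk_left] with x hx hm
  refine (hx.add hK.norm).mono' hm (ae_of_all _ fun z => ?_)
  simp only [norm_smul, Real.norm_eq_abs, Pi.add_apply]
  -- `|t| ≤ t² + 1`
  have h3 := norm_nonneg (K z)
  nlinarith [mul_nonneg (sq_nonneg (|u (x + z) - u x| - 1)) h3,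
    sq_abs (u (x + z) - u x), mul_nonneg (sq_nonneg (u (x + z) - u x)) h3]

/-- Averaging the increments of a square integrable function against an integrable kernel gives a
square integrable function. -/
lemma memLp_integral_sub_smul {u : E → ℝ} {K : E → F} (hu : MemLp u 2 μ) (hK : Integrable K μ) :
    MemLp (fun x => ∫ z, (u (x + z) - u x) • K z ∂μ) 2 μ := by
  have hm := (aestronglyMeasurable_sub_smul hu.1 hK.1).integral_prod_right'
  refine (memLp_two_iff_integrable_sq_norm hm).2 ?_
  have hsq := integrable_sub_sq_mul hu hK.norm
  refine (hsq.integral_prod_left.const_mul (∫ z, ‖K z‖ ∂μ)).mono' (hm.norm.pow 2) ?_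
  filter_upwards [hsq.prod_right_ae, ae_integrable_sub_smul hu hK] with x h2 h1
  have h1' : Integrable (fun z => |u (x + z) - u x| * ‖K z‖) μ := by
    simpa only [norm_smul, Real.norm_eq_abs] using h1.norm
  have hcs := sq_integral_mul_le (a := fun z => |u (x + z) - u x|) (fun z => norm_nonneg (K z))
    hK.norm h1' (by simpa only [sq_abs] using h2)
  have hn := norm_integral_le_integral_norm (μ := μ) fun z => (u (x + z) - u x) • K z
  simp only [norm_smul, Real.norm_eq_abs, sq_abs] at hn hcs
  rw [Real.norm_eq_abs, abs_of_nonneg (sq_nonneg _)]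
  exact (pow_le_pow_left₀ (norm_nonneg _) hn 2).trans hcs

/-- Nonlocal integration by parts: the averaged forward increment of `u` and the averaged backward
increment of `φ` are adjoint to each other. -/
lemma integral_inner_integral_sub_smul [CompleteSpace F] {u : E → ℝ} {K φ : E → F}
    (hu : MemLp u 2 μ) (hK : Integrable K μ) (hφ : MemLp φ 2 μ) :
    ∫ x, inner ℝ (∫ z, (u (x + z) - u x) • K z ∂μ) (φ x) ∂μ
      = ∫ x, u x * ∫ z, inner ℝ (K z) (φ (x - z) - φ x) ∂μ ∂μ := by
  have i1 := integrable_translate_mul_inner hu hK hφ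
  have i2 := integrable_mul_inner hu hK hφ
  have i3 : Integrable (fun p : E × E => u p.1 * inner ℝ (K p.2) (φ (p.1 - p.2))) (μ.prod μ) := by
    have := (measurePreserving_sub_prod μ μ).integrable_comp_of_integrable i1
    simpa [Function.comp_def] using this
  have e13 : ∫ p : E × E, u (p.1 + p.2) * inner ℝ (K p.2) (φ p.1) ∂(μ.prod μ)
      = ∫ p : E × E, u p.1 * inner ℝ (K p.2) (φ (p.1 - p.2)) ∂(μ.prod μ) := by
    have hs := measurePreserving_add_prod μ μ
    have := integral_map (f := fun p : E × E => u p.1 * inner ℝ (K p.2) (φ (p.1 - p.2)))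
      hs.measurable.aemeasurable (by rw [hs.map_eq]; exact i3.1)
    rw [hs.map_eq] at this
    simpa using this.symm
  have eL : ∫ x, inner ℝ (∫ z, (u (x + z) - u x) • K z ∂μ) (φ x) ∂μ
      = ∫ x, ∫ z, (u (x + z) * inner ℝ (K z) (φ x) - u x * inner ℝ (K z) (φ x)) ∂μ ∂μ := by
    refine integral_congr_ae ?_
    filter_upwards [ae_integrable_sub_smul hu hK] with x hx
    rw [real_inner_comm, ← integral_inner hx]
    refine integral_congr_ae (ae_of_all _ fun z => ?_)
    simp only [inner_smul_right, real_inner_comm (K z)]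
    ring
  have eR : ∫ x, u x * ∫ z, inner ℝ (K z) (φ (x - z) - φ x) ∂μ ∂μ
      = ∫ x, ∫ z, (u x * inner ℝ (K z) (φ (x - z)) - u x * inner ℝ (K z) (φ x)) ∂μ ∂μ := by
    refine integral_congr_ae (ae_of_all _ fun x => ?_)
    simp only [← integral_const_mul, inner_sub_right, mul_sub]
  rw [eL, eR, integral_integral_sub i1 i2, integral_integral_sub i3 i2,
    ← integral_prod _ i1, ← integral_prod _ i3, e13]

end Increments

/-! ### The energy identity and coercivity -/

lemma integral_norm_sq_eq_eLpNorm_toReal_sq {α F : Type*} [MeasurableSpace α]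
    [NormedAddCommGroup F] {μ : Measure α} {f : α → F} (hf : MemLp f 2 μ) :
    ∫ x, ‖f x‖ ^ 2 ∂μ = (eLpNorm f 2 μ).toReal ^ 2 := by
  have h0 : 0 ≤ ∫ x, ‖f x‖ ^ 2 ∂μ := integral_nonneg fun x => sq_nonneg _
  rw [hf.eLpNorm_eq_integral_rpow_norm (by norm_num) (by norm_num)]
  simp only [ENNReal.toReal_ofNat, Real.rpow_ofNat]
  rw [ENNReal.toReal_ofReal (Real.rpow_nonneg h0 _), ← Real.rpow_natCast, ← Real.rpow_mul h0]
  norm_num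

lemma eLpNorm_translate_nsmul_sub_le {E F : Type*} [NormedAddCommGroup E] [MeasurableSpace E]
    [BorelSpace E] {μ : Measure E} [μ.IsAddRightInvariant] [NormedAddCommGroup F] {u : E → F}
    (hu : AEStronglyMeasurable u μ) {p : ENNReal} (hp : 1 ≤ p) (z : E) (n : ℕ) :
    eLpNorm (fun x => u (x + n • z) - u x) p μ
      ≤ n * eLpNorm (fun x => u (x + z) - u x) p μ := by
  have hmp (y : E) : MeasurePreserving (fun x => x + y) μ μ := measurePreserving_add_right μ y
  have hm (y : E) : AEStronglyMeasurable (fun x => u (x + y)) μ :=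
    hu.comp_measurePreserving (hmp y)
  induction n with
  | zero => simp
  | succ n ih =>
    have h1 : eLpNorm (fun x => u (x + n • z + z) - u (x + n • z)) p μ
        = eLpNorm (fun x => u (x + z) - u x) p μ :=
      eLpNorm_comp_measurePreserving (g := fun x => u (x + z) - u x) ((hm z).sub hu) (hmp (n • z))
    have h2 : (fun x => u (x + (n + 1) • z) - u x)
        = (fun x => u (x + n • z + z) - u (x + n • z)) + fun x => u (x + n • z) - u x := by
      funext x
      simp [add_smul, add_assoc]
    rw [h2]
    refine (eLpNorm_add_le ?_ ((hm _).sub hu) hp).trans ?_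
    · exact ((hm z).sub hu).comp_measurePreserving (hmp (n • z))
    · rw [h1]
      push_cast
      rw [add_mul, one_mul, add_comm]
      exact add_le_add ih le_rfl

/-- If `n • z` translates `Ω` off itself, then the increment by `z` of a function supported in `Ω`
controls the function. -/
lemma integral_sq_le_of_translate_disjoint {E : Type*} [NormedAddCommGroup E]
    [MeasurableSpace E] [BorelSpace E] {μ : Measure E} [μ.IsAddRightInvariant] {u : E → ℝ} (hu : MemLp u 2 μ) {Ω : Set E}
    (hu0 : ∀ᵐ x ∂μ, x ∉ Ω → u x = 0) {n : ℕ} {z : E}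
    (hz : ∀ x ∈ Ω, x + n • z ∉ Ω) :
    ∫ x, u x ^ 2 ∂μ ≤ n ^ 2 * ∫ x, (u (x + z) - u x) ^ 2 ∂μ := by
  have hmp (y : E) : MeasurePreserving (fun x => x + y) μ μ := measurePreserving_add_right μ y
  have hdiff : MemLp (fun x => u (x + z) - u x) 2 μ :=
    (hu.comp_measurePreserving (hmp z)).sub hu
  have h1 : eLpNorm u 2 μ ≤ n * eLpNorm (fun x => u (x + z) - u x) 2 μ := by
    refine le_trans ?_ (eLpNorm_translate_nsmul_sub_le hu.1 one_le_two z n)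
    refine eLpNorm_mono_ae ?_
    filter_upwards [hu0, (hmp (n • z)).quasiMeasurePreserving.ae hu0] with x hx hxz
    by_cases hxΩ : x ∈ Ω
    · simp [hxz (hz x hxΩ)]
    · simp [hx hxΩ]
  have h2 := ENNReal.toReal_mono
    (ENNReal.mul_ne_top (ENNReal.natCast_ne_top n) hdiff.eLpNorm_ne_top) h1
  rw [ENNReal.toReal_mul, ENNReal.toReal_natCast] at h2
  have h3 := pow_le_pow_left₀ ENNReal.toReal_nonneg h2 2
  rw [mul_pow, ← integral_norm_sq_eq_eLpNorm_toReal_sq hu,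
    ← integral_norm_sq_eq_eLpNorm_toReal_sq hdiff] at h3
  simpa only [Real.norm_eq_abs, sq_abs] using h3

section Coercivity

variable {E : Type*} [NormedAddCommGroup E] [NormedSpace ℝ E] [FiniteDimensional ℝ E]
  [MeasurableSpace E] [BorelSpace E] {μ : Measure E} [μ.IsAddHaarMeasure]

/-- The energy identity: pairing `u` with its averaged increment gives minus one half of the
averaged squared increments. -/
lemma integral_mul_integral_sub_mul {u k : E → ℝ} (hu : MemLp u 2 μ) (hk : Integrable k μ) :
    ∫ x, u x * ∫ z, (u (x + z) - u x) * k z ∂μ ∂μ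
      = -(1 / 2) * ∫ z, (∫ x, (u (x + z) - u x) ^ 2 ∂μ) * k z ∂μ := by
  have i1 := integrable_translate_sq_mul hu hk
  have i2 := Integrable.mul_prod hu.integrable_sq hk
  have i3 := integrable_sub_sq_mul hu hk
  have e12 : ∫ p : E × E, u (p.1 + p.2) ^ 2 * k p.2 ∂(μ.prod μ)
      = ∫ p : E × E, u p.1 ^ 2 * k p.2 ∂(μ.prod μ) := by
    have hs := measurePreserving_add_prod μ μ
    have := integral_map (f := fun p : E × E => u p.1 ^ 2 * k p.2)
      hs.measurable.aemeasurable (by rw [hs.map_eq]; exact i2.1)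
    rw [hs.map_eq] at this
    exact this.symm
  have hpt : (fun p : E × E => u p.1 * ((u (p.1 + p.2) - u p.1) * k p.2))
      = fun p => (1 / 2) * (u (p.1 + p.2) ^ 2 * k p.2 - u p.1 ^ 2 * k p.2)
        - (1 / 2) * ((u (p.1 + p.2) - u p.1) ^ 2 * k p.2) := by
    funext p
    ring
  have i12 := (i1.sub i2).const_mul (1 / 2)
  have i4 : Integrable (fun p : E × E => u p.1 * ((u (p.1 + p.2) - u p.1) * k p.2))
      (μ.prod μ) := by
    rw [hpt]
    exact i12.sub (i3.const_mul _)
  calc ∫ x, u x * ∫ z, (u (x + z) - u x) * k z ∂μ ∂μ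
      = ∫ x, ∫ z, u x * ((u (x + z) - u x) * k z) ∂μ ∂μ := by simp only [integral_const_mul]
    _ = ∫ p : E × E, u p.1 * ((u (p.1 + p.2) - u p.1) * k p.2) ∂(μ.prod μ) :=
      (integral_prod _ i4).symm
    _ = -(1 / 2) * ∫ p : E × E, (u (p.1 + p.2) - u p.1) ^ 2 * k p.2 ∂(μ.prod μ) := by
      rw [hpt, integral_sub (by exact i12) (i3.const_mul _), integral_const_mul,
        integral_const_mul, integral_sub i1 i2, e12]
      ring
    _ = _ := by
      rw [integral_prod_symm _ i3]
      simp only [integral_mul_const]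

/-- Coercivity of the energy: if `n • z` translates `Ω` off itself for every `z ∈ S`, then the
energy of a function supported in `Ω` is bounded below in terms of the mass of the kernel
on `S`. -/
lemma setIntegral_mul_integral_sq_le {u k : E → ℝ} (hu : MemLp u 2 μ) (hk : Integrable k μ)
    (hk0 : ∀ z, 0 ≤ k z) {Ω S : Set E} (hS : MeasurableSet S)
    (hu0 : ∀ᵐ x ∂μ, x ∉ Ω → u x = 0) {n : ℕ} (hn : ∀ z ∈ S, ∀ x ∈ Ω, x + n • z ∉ Ω) :
    (∫ z in S, k z ∂μ) * ∫ x, u x ^ 2 ∂μ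
      ≤ n ^ 2 * ∫ z, (∫ x, (u (x + z) - u x) ^ 2 ∂μ) * k z ∂μ := by
  have hi : Integrable (fun z => (∫ x, (u (x + z) - u x) ^ 2 ∂μ) * k z) μ := by
    simpa only [integral_mul_const] using (integrable_sub_sq_mul hu hk).integral_prod_right
  rw [← integral_mul_const, ← integral_const_mul]
  calc ∫ z in S, k z * ∫ x, u x ^ 2 ∂μ ∂μ
      ≤ ∫ z in S, n ^ 2 * ((∫ x, (u (x + z) - u x) ^ 2 ∂μ) * k z) ∂μ := by
        refine setIntegral_mono_on (hk.mul_const _).integrableOn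
          (hi.const_mul _).integrableOn hS fun z hz => ?_
        have := mul_le_mul_of_nonneg_left
          (integral_sq_le_of_translate_disjoint hu hu0 (hn z hz)) (hk0 z)
        linarith
    _ ≤ ∫ z, n ^ 2 * ((∫ x, (u (x + z) - u x) ^ 2 ∂μ) * k z) ∂μ :=
        setIntegral_le_integral (hi.const_mul _) <| ae_of_all _ fun z =>
          mul_nonneg (by positivity) (mul_nonneg (integral_nonneg fun x => sq_nonneg _) (hk0 z))

end Coercivity

/-! ### Principal values -/

/-- The principal value at `x` of an integrable function vanishing at `x` is its integral. -/
lemma tendsto_setIntegral_compl_ball {X F : Type*} [PseudoMetricSpace X] [T0Space X]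
    [MeasurableSpace X] [OpensMeasurableSpace X] {μ : Measure X} [NormedAddCommGroup F]
    [NormedSpace ℝ F] {f : X → F} (hf : Integrable f μ) {x : X} (hx : f x = 0) :
    Tendsto (fun ε : ℝ => ∫ y in (Metric.ball x ε)ᶜ, f y ∂μ) (𝓝[>] 0) (𝓝 (∫ y, f y ∂μ)) := by
  have hm (ε : ℝ) : MeasurableSet (Metric.ball x ε)ᶜ := Metric.isOpen_ball.measurableSet.compl
  simp_rw [← integral_indicator (hm _)]
  refine tendsto_integral_filter_of_dominated_convergence (fun y => ‖f y‖)
    (Eventually.of_forall fun ε => hf.1.indicator (hm ε))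
    (Eventually.of_forall fun ε => ae_of_all _ fun y => norm_indicator_le_norm_self _ _)
    hf.norm (ae_of_all _ fun y => ?_)
  refine tendsto_const_nhds.congr' ?_
  by_cases hy : y = x
  · filter_upwards with ε
    rw [hy, Set.indicator_apply_eq_self.2 fun _ => hx, hx]
  · have hpos : 0 < dist y x := by
      rcases (dist_nonneg (x := y) (y := x)).eq_or_lt with h | h
      · exact absurd (Metric.inseparable_iff.2 h.symm).eq hy
      · exact h
    filter_upwards [Ioo_mem_nhdsGT hpos] with ε hε
    rw [Set.indicator_of_mem]
    simpa using hε.2.le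

/-! ### The half-ball gradient for an integrable kernel -/

/-- The vector kernel `χ_ν(z) w(z) z/|z|` of the half-ball operators. -/
noncomputable def halfBallKernel {d : ℕ} (w : EuclideanSpace ℝ (Fin d) → ℝ)
    (ν z : EuclideanSpace ℝ (Fin d)) : EuclideanSpace ℝ (Fin d) :=
  (halfSpaceChar ν z * w z) • (‖z‖⁻¹ • z)

section HalfBall

variable {d : ℕ} {w : EuclideanSpace ℝ (Fin d) → ℝ} {ν : EuclideanSpace ℝ (Fin d)}

lemma halfBallGradIntegrand_eq (u : EuclideanSpace ℝ (Fin d) → ℝ)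
    (x y : EuclideanSpace ℝ (Fin d)) :
    halfBallGradIntegrand w ν u x y = (u y - u x) • halfBallKernel w ν (y - x) := by
  rw [halfBallGradIntegrand, halfBallKernel, smul_smul _ _ (‖y - x‖⁻¹ • (y - x))]
  congr 1
  ring

lemma halfBallDivIntegrand_eq (v : EuclideanSpace ℝ (Fin d) → EuclideanSpace ℝ (Fin d))
    (x y : EuclideanSpace ℝ (Fin d)) :
    halfBallDivIntegrand w ν v x y = inner ℝ (halfBallKernel w ν (y - x)) (v y - v x) := by
  rw [halfBallDivIntegrand, halfBallKernel, real_inner_smul_left _ _ (halfSpaceChar ν _ * _)]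
  ring

lemma halfBallKernel_neg_dir (hrad : ∀ x y, ‖x‖ = ‖y‖ → w x = w y)
    (z : EuclideanSpace ℝ (Fin d)) :
    halfBallKernel w (-ν) z = -halfBallKernel w ν (-z) := by
  simp [halfBallKernel, halfSpaceChar, Set.indicator_apply, hrad (-z) z (norm_neg z)]

lemma norm_halfBallKernel_le (hw0 : ∀ x, 0 ≤ w x) (z : EuclideanSpace ℝ (Fin d)) :
    ‖halfBallKernel w ν z‖ ≤ w z := by
  have h1 : ‖‖z‖⁻¹ • z‖ ≤ 1 := by
    rw [norm_smul, norm_inv, norm_norm]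
    exact inv_mul_le_one
  have h2 : ‖halfSpaceChar ν z * w z‖ ≤ w z := by
    rw [halfSpaceChar, Set.indicator_apply]
    split_ifs <;> simp [abs_of_nonneg, hw0 z]
  rw [halfBallKernel, norm_smul]
  exact (mul_le_mul h2 h1 (norm_nonneg _) (hw0 z)).trans_eq (mul_one _)

lemma integrable_halfBallKernel (hw0 : ∀ x, 0 ≤ w x) (hw : Integrable w volume)
    (ν : EuclideanSpace ℝ (Fin d)) : Integrable (halfBallKernel w ν) volume := by
  refine hw.mono' (AEStronglyMeasurable.smul (AEStronglyMeasurable.mul ?_ hw.1) ?_)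
    (ae_of_all _ (norm_halfBallKernel_le hw0))
  · have hS : MeasurableSet {z' : EuclideanSpace ℝ (Fin d) | 0 ≤ inner ℝ z' ν} :=
      (isClosed_le (by fun_prop) (by fun_prop)).measurableSet
    exact (measurable_const.indicator hS).aestronglyMeasurable
  · exact (measurable_norm.inv.smul measurable_id).aestronglyMeasurable

lemma inner_halfBallKernel (z : EuclideanSpace ℝ (Fin d)) :
    inner ℝ (halfBallKernel w ν z) ν = halfSpaceChar ν z * w z * (‖z‖⁻¹ * inner ℝ z ν) := by
  rw [halfBallKernel, real_inner_smul_left, real_inner_smul_left]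

lemma inner_halfBallKernel_nonneg (hw0 : ∀ x, 0 ≤ w x) (z : EuclideanSpace ℝ (Fin d)) :
    0 ≤ inner ℝ (halfBallKernel w ν z) ν := by
  rw [inner_halfBallKernel, halfSpaceChar, Set.indicator_apply]
  split_ifs with h
  · have h' : 0 ≤ inner ℝ z ν := h
    have := hw0 z
    positivity
  · simp

/-- Where the half-ball gradient integrand is integrable, the principal value exists and is the
averaged increment of `u` against the kernel. -/
lemma hasHalfBallGradAt_of_integrable {u : EuclideanSpace ℝ (Fin d) → ℝ}
    {x : EuclideanSpace ℝ (Fin d)}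
    (h : Integrable (fun z => (u (x + z) - u x) • halfBallKernel w ν z) volume) :
    HasHalfBallGradAt w ν u x (∫ z, (u (x + z) - u x) • halfBallKernel w ν z) := by
  have h1 : Integrable (halfBallGradIntegrand w ν u x) volume := by
    have := h.comp_sub_right x
    simpa only [add_sub_cancel, ← halfBallGradIntegrand_eq] using this
  have h2 : ∫ z, (u (x + z) - u x) • halfBallKernel w ν z
      = ∫ y, halfBallGradIntegrand w ν u x y := by
    rw [← integral_sub_right_eq_self _ x]
    simp only [add_sub_cancel, ← halfBallGradIntegrand_eq]
  rw [h2]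
  exact ⟨fun ε _ => h1.integrableOn,
    tendsto_setIntegral_compl_ball h1 (by simp [halfBallGradIntegrand])⟩

lemma ae_hasHalfBallGradAt (hw0 : ∀ x, 0 ≤ w x) (hw : Integrable w volume)
    {u : EuclideanSpace ℝ (Fin d) → ℝ} (hu : MemLp u 2 volume) :
    ∀ᵐ x, HasHalfBallGradAt w ν u x (∫ z, (u (x + z) - u x) • halfBallKernel w ν z) := by
  filter_upwards [ae_integrable_sub_smul hu (integrable_halfBallKernel hw0 hw ν)] with x hx
  exact hasHalfBallGradAt_of_integrable hx

lemma halfBallGrad_ae_eq (hw0 : ∀ x, 0 ≤ w x) (hw : Integrable w volume)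
    {u : EuclideanSpace ℝ (Fin d) → ℝ} (hu : MemLp u 2 volume) :
    halfBallGrad w ν u =ᵐ[volume] fun x => ∫ z, (u (x + z) - u x) • halfBallKernel w ν z := by
  filter_upwards [ae_hasHalfBallGradAt (ν := ν) hw0 hw hu] with x hx
  exact hx.2.limUnder_eq

/-- The half-ball divergence in direction `-ν` of a bounded continuous field, as an average of
backward increments against the kernel of direction `ν`. -/
lemma halfBallDiv_neg_dir_eq (hw0 : ∀ x, 0 ≤ w x) (hrad : ∀ x y, ‖x‖ = ‖y‖ → w x = w y)
    (hw : Integrable w volume) {φ : EuclideanSpace ℝ (Fin d) → EuclideanSpace ℝ (Fin d)}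
    (hφ : Continuous φ) {C : ℝ} (hC : ∀ x, ‖φ x‖ ≤ C) (x : EuclideanSpace ℝ (Fin d)) :
    halfBallDiv w (-ν) φ x = -∫ z, inner ℝ (halfBallKernel w ν z) (φ (x - z) - φ x) := by
  have hK := integrable_halfBallKernel hw0 hw (-ν)
  have h1 : Integrable (halfBallDivIntegrand w (-ν) φ x) volume := by
    have h : Integrable (fun z => inner ℝ (halfBallKernel w (-ν) z) (φ (x + z) - φ x)) := by
      refine (hK.norm.mul_const (C + C)).mono'
        (hK.1.inner (by fun_prop)) (ae_of_all _ fun z => ?_)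
      refine (norm_inner_le_norm _ _).trans ?_
      gcongr
      exact (norm_sub_le _ _).trans (add_le_add (hC _) (hC _))
    have := h.comp_sub_right x
    simpa only [add_sub_cancel, ← halfBallDivIntegrand_eq] using this
  have h2 : halfBallDiv w (-ν) φ x = ∫ y, halfBallDivIntegrand w (-ν) φ x y :=
    (tendsto_setIntegral_compl_ball h1 (by simp [halfBallDivIntegrand])).limUnder_eq
  rw [h2, ← integral_sub_left_eq_self _ volume x, ← integral_neg]
  refine integral_congr_ae (ae_of_all _ fun z => ?_)
  simp [halfBallDivIntegrand_eq, halfBallKernel_neg_dir hrad]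

/-- For an integrable kernel every square integrable function has a square integrable
distributional half-ball gradient, namely the pointwise one. -/
lemma isL2DistHalfBallGrad_halfBallGrad (hw0 : ∀ x, 0 ≤ w x)
    (hrad : ∀ x y, ‖x‖ = ‖y‖ → w x = w y) (hw : Integrable w volume)
    {u : EuclideanSpace ℝ (Fin d) → ℝ} (hu : MemLp u 2 volume) :
    IsL2DistHalfBallGrad w ν u (halfBallGrad w ν u) := by
  have hK := integrable_halfBallKernel hw0 hw ν
  have hae := halfBallGrad_ae_eq (ν := ν) hw0 hw hu
  refine ⟨(memLp_congr_ae hae).2 (memLp_integral_sub_smul hu hK), fun φ hφ hφc => ?_⟩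
  obtain ⟨C, hC⟩ := hφ.continuous.bounded_above_of_compact_support hφc
  have h1 : ∫ x, inner ℝ (halfBallGrad w ν u x) (φ x)
      = ∫ x, inner ℝ (∫ z, (u (x + z) - u x) • halfBallKernel w ν z) (φ x) := by
    refine integral_congr_ae ?_
    filter_upwards [hae] with x hx
    rw [hx]
  rw [h1, integral_inner_integral_sub_smul hu hK (hφ.continuous.memLp_of_hasCompactSupport hφc),
    distHalfBallGrad, ← integral_neg]
  simp only [halfBallDiv_neg_dir_eq hw0 hrad hw hφ.continuous hC, mul_neg, neg_neg]

/-- The distributional half-ball gradient is unique up to null sets: test against fields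
`η e_i`. -/
lemma IsL2DistHalfBallGrad.ae_eq {u : EuclideanSpace ℝ (Fin d) → ℝ}
    {g h : EuclideanSpace ℝ (Fin d) → EuclideanSpace ℝ (Fin d)}
    (hg : IsL2DistHalfBallGrad w ν u g) (hh : IsL2DistHalfBallGrad w ν u h) :
    g =ᵐ[volume] h := by
  have key : ∀ᵐ x, g x - h x = 0 := by
    refine ae_eq_zero_of_integral_contDiff_smul_eq_zero
      ((hg.1.sub hh.1).locallyIntegrable one_le_two) fun η hη hηc => ?_
    have hη2 : MemLp η 2 volume := hη.continuous.memLp_of_hasCompactSupport hηc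
    have hint {f : EuclideanSpace ℝ (Fin d) → EuclideanSpace ℝ (Fin d)} (hf : MemLp f 2 volume) :
        Integrable (fun x => η x • f x) volume := memLp_one_iff_integrable.1 (hf.smul hη2)
    have hpair {f : EuclideanSpace ℝ (Fin d) → EuclideanSpace ℝ (Fin d)}
        (hf : MemLp f 2 volume) (c : EuclideanSpace ℝ (Fin d)) :
        ∫ x, inner ℝ (f x) (η x • c) = inner ℝ c (∫ x, η x • f x) := by
      rw [← integral_inner (hint hf)]
      simp only [inner_smul_right, real_inner_comm c]
    simp only [smul_sub]
    rw [integral_sub (hint hg.1) (hint hh.1), sub_eq_zero]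
    refine ext_inner_left ℝ fun c => ?_
    have hc : ContDiff ℝ ∞ (fun x => η x • c) := hη.smul contDiff_const
    have hcc : HasCompactSupport (fun x => η x • c) := hηc.smul_right
    rw [← hpair hg.1, ← hpair hh.1, ← hg.2 _ hc hcc, ← hh.2 _ hc hcc]
  filter_upwards [key] with x hx
  exact sub_eq_zero.1 hx

/-! ### The Poincaré inequality -/

/-- The energy identity tested with `ν`, combined with Young's inequality. -/
lemma sq_mul_integral_sq_le_of_coercive (hw0 : ∀ x, 0 ≤ w x) (hw : Integrable w volume)
    (hν : ‖ν‖ = 1) {u : EuclideanSpace ℝ (Fin d) → ℝ} (hu : MemLp u 2 volume) {c : ℝ}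
    (hc : 0 < c)
    (h : 2 * c * ∫ x, u x ^ 2
      ≤ ∫ z, (∫ x, (u (x + z) - u x) ^ 2) * inner ℝ (halfBallKernel w ν z) ν) :
    c ^ 2 * ∫ x, u x ^ 2 ≤ ∫ x, ‖∫ z, (u (x + z) - u x) • halfBallKernel w ν z‖ ^ 2 := by
  have hK := integrable_halfBallKernel hw0 hw ν
  have hG := memLp_integral_sub_smul hu hK
  have hk := hK.inner_const (𝕜 := ℝ) ν
  have hid := integral_mul_integral_sub_mul hu hk
  have hh : MemLp (fun x => ∫ z, (u (x + z) - u x) * inner ℝ (halfBallKernel w ν z) ν) 2 volume :=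
    memLp_integral_sub_smul hu hk
  have iu := hu.integrable_sq.const_mul (c / 2)
  have iG := ((memLp_two_iff_integrable_sq_norm hG.1).1 hG).const_mul (2 * c)⁻¹
  have hle : -(∫ x, u x * ∫ z, (u (x + z) - u x) * inner ℝ (halfBallKernel w ν z) ν)
      ≤ ∫ x, (c / 2 * u x ^ 2
        + (2 * c)⁻¹ * ‖∫ z, (u (x + z) - u x) • halfBallKernel w ν z‖ ^ 2) := by
    rw [← integral_neg]
    refine integral_mono_ae (hu.integrable_mul hh).neg (iu.add iG) ?_
    filter_upwards [ae_integrable_sub_smul hu hK] with x hx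
    have hin : ∫ z, (u (x + z) - u x) * inner ℝ (halfBallKernel w ν z) ν
        = inner ℝ ν (∫ z, (u (x + z) - u x) • halfBallKernel w ν z) := by
      rw [← integral_inner hx]
      simp only [inner_smul_right, real_inner_comm ν]
    simp only [hin]
    set G := ∫ z, (u (x + z) - u x) • halfBallKernel w ν z
    have hνG := abs_real_inner_le_norm ν G
    rw [hν, one_mul] at hνG
    have h1 : -(u x * inner ℝ ν G) ≤ |u x| * ‖G‖ :=
      (neg_le_abs _).trans ((abs_mul _ _).trans_le (by gcongr))
    -- Young's inequality `|u| ‖G‖ ≤ (c/2) u² + ‖G‖²/(2c)` as a completed square.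
    have h2 : c / 2 * u x ^ 2 + (2 * c)⁻¹ * ‖G‖ ^ 2 - |u x| * ‖G‖
        = (2 * c)⁻¹ * (c * |u x| - ‖G‖) ^ 2 := by
      rw [← sq_abs (u x)]
      field_simp
      ring
    have h3 : 0 ≤ (2 * c)⁻¹ * (c * |u x| - ‖G‖) ^ 2 := by positivity
    linarith
  rw [integral_add iu iG, integral_const_mul, integral_const_mul, hid] at hle
  have h4 : c / 2 * ∫ x, u x ^ 2
      ≤ (2 * c)⁻¹ * ∫ x, ‖∫ z, (u (x + z) - u x) • halfBallKernel w ν z‖ ^ 2 := by linarith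
  have h5 := mul_le_mul_of_nonneg_left h4 (by positivity : 0 ≤ 2 * c)
  rw [mul_inv_cancel_left₀ (by positivity)] at h5
  linarith

/-- The kernel in direction `ν` has positive mass on any annulus contained in the set where `w` is
positive. -/
lemma setIntegral_annulus_pos (hw0 : ∀ x, 0 ≤ w x) (hw : Integrable w volume)
    (hν : ‖ν‖ = 1) {ε : ℝ} (hε : 0 < ε) (hpos : ∀ x, 0 < ‖x‖ → ‖x‖ ≤ ε → 0 < w x) :
    0 < ∫ z in {z : EuclideanSpace ℝ (Fin d) | ε / 2 < ‖z‖ ∧ ‖z‖ < ε},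
      inner ℝ (halfBallKernel w ν z) ν := by
  have hK := (integrable_halfBallKernel hw0 hw ν).inner_const (𝕜 := ℝ) ν
  rw [setIntegral_pos_iff_support_of_nonneg_ae
    (ae_of_all _ fun z => inner_halfBallKernel_nonneg hw0 z) hK.integrableOn]
  have hhalf : IsOpen {z : EuclideanSpace ℝ (Fin d) | 0 < inner ℝ z ν} :=
    isOpen_lt continuous_const (by fun_prop)
  have hopen : IsOpen {z : EuclideanSpace ℝ (Fin d) | 0 < inner ℝ z ν ∧ ε / 2 < ‖z‖ ∧ ‖z‖ < ε} :=
    hhalf.inter (isOpen_Ioo.preimage continuous_norm)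
  have hne :
      {z : EuclideanSpace ℝ (Fin d) | 0 < inner ℝ z ν ∧ ε / 2 < ‖z‖ ∧ ‖z‖ < ε}.Nonempty := by
    have habs : |3 * ε / 4| = 3 * ε / 4 := abs_of_pos (by positivity)
    refine ⟨(3 * ε / 4) • ν, ?_, ?_, ?_⟩
    · rw [real_inner_smul_left, real_inner_self_eq_norm_sq, hν]
      positivity
    · rw [norm_smul, hν, Real.norm_eq_abs, habs]
      linarith
    · rw [norm_smul, hν, Real.norm_eq_abs, habs]
      linarith
  refine (hopen.measure_pos volume hne).trans_le (measure_mono fun z hz => ⟨?_, hz.2⟩)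
  have hz0 : 0 < ‖z‖ := (half_pos hε).trans hz.2.1
  have hmem : halfSpaceChar ν z = 1 := by
    simp [halfSpaceChar, hz.1.le]
  rw [Function.mem_support, inner_halfBallKernel, hmem, one_mul]
  exact (mul_pos (hpos z hz0 hz.2.2.le) (mul_pos (inv_pos.2 hz0) hz.1)).ne'

/-- The `L²` Poincaré inequality for the pointwise half-ball gradient. -/
lemma exists_eLpNorm_le_halfBallGrad (hw : IsHalfBallKernel w) (hw_int : Integrable w volume)
    {Ω : Set (EuclideanSpace ℝ (Fin d))} (hΩ : Bornology.IsBounded Ω) (hν : ‖ν‖ = 1) :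
    ∃ C : ℝ, 0 < C ∧ ∀ u : EuclideanSpace ℝ (Fin d) → ℝ, MemLp u 2 volume →
      (∀ᵐ x, x ∉ Ω → u x = 0) →
      eLpNorm u 2 volume ≤ ENNReal.ofReal C * eLpNorm (halfBallGrad w ν u) 2 volume := by
  obtain ⟨ε, hε, -, hpos⟩ := hw.pos_near_zero
  -- `n` steps of length more than `ε / 2` exceed the diameter of `Ω`.
  obtain ⟨n, hn⟩ := exists_nat_gt (Metric.diam Ω / (ε / 2))
  have hn' : Metric.diam Ω < n * (ε / 2) := (div_lt_iff₀ (half_pos hε)).1 hn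
  have hn0 : 0 < (n : ℝ) := (div_nonneg Metric.diam_nonneg (half_pos hε).le).trans_lt hn
  set S := {z : EuclideanSpace ℝ (Fin d) | ε / 2 < ‖z‖ ∧ ‖z‖ < ε}
  have hSm : MeasurableSet S :=
    (isOpen_Ioo.preimage continuous_norm).measurableSet
  have hm := setIntegral_annulus_pos hw.nonneg hw_int hν hε hpos
  set m := ∫ z in S, inner ℝ (halfBallKernel w ν z) ν with hm_def
  have hdisj : ∀ z ∈ S, ∀ x ∈ Ω, x + n • z ∉ Ω := fun z hz x hx hxz => by
    have h1 := Metric.dist_le_diam_of_mem hΩ hxz hx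
    rw [dist_eq_norm, add_sub_cancel_left, ← Nat.cast_smul_eq_nsmul ℝ n z, norm_smul,
      Real.norm_natCast] at h1
    nlinarith [hz.1]
  have hc : 0 < m / (2 * n ^ 2) := by positivity
  refine ⟨(m / (2 * n ^ 2))⁻¹, inv_pos.2 hc, fun u hu hu0 => ?_⟩
  set c := m / (2 * n ^ 2) with hc_def
  have hco := setIntegral_mul_integral_sq_le hu
    ((integrable_halfBallKernel hw.nonneg hw_int ν).inner_const (𝕜 := ℝ) ν)
    (inner_halfBallKernel_nonneg hw.nonneg) hSm hu0 hdisj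
  have hG := memLp_integral_sub_smul hu (integrable_halfBallKernel hw.nonneg hw_int ν)
  have hkey := sq_mul_integral_sq_le_of_coercive hw.nonneg hw_int hν hu hc (by
    have hcm : 2 * c * n ^ 2 = m := by
      rw [hc_def]
      field_simp
    rw [← hm_def, ← hcm] at hco
    have : 0 < (n : ℝ) ^ 2 := by positivity
    refine le_of_mul_le_mul_left ?_ this
    linarith)
  have husq := integral_norm_sq_eq_eLpNorm_toReal_sq hu
  simp only [Real.norm_eq_abs, sq_abs] at husq
  rw [husq, integral_norm_sq_eq_eLpNorm_toReal_sq hG, ← mul_pow] at hkey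
  have hle := le_of_sq_le_sq hkey ENNReal.toReal_nonneg
  rw [eLpNorm_congr_ae (halfBallGrad_ae_eq hw.nonneg hw_int hu),
    ← ENNReal.ofReal_toReal hu.eLpNorm_ne_top, ← ENNReal.ofReal_toReal hG.eLpNorm_ne_top,
    ← ENNReal.ofReal_mul (inv_pos.2 hc).le]
  refine ENNReal.ofReal_le_ofReal ?_
  rw [inv_mul_eq_div, le_div_iff₀ hc]
  linarith

end HalfBall

theorem theorem4p1 {d : ℕ} (w : EuclideanSpace ℝ (Fin d) → ℝ)
    (hw : IsHalfBallKernel w) (hw_int : Integrable w volume)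
    (hw_supp : ∃ K : Set (EuclideanSpace ℝ (Fin d)), IsCompact K ∧
      ∀ᵐ x ∂volume, x ∉ K → w x = 0)
    (Ω : Set (EuclideanSpace ℝ (Fin d))) (hΩ_open : IsOpen Ω) (hΩ_conn : IsConnected Ω)
    (hΩ_bdd : Bornology.IsBounded Ω)
    (ν : EuclideanSpace ℝ (Fin d)) (hν : ‖ν‖ = 1) :
    halfBallEnergySpace w ν Ω =
        {u | MemLp u 2 volume ∧ ∀ᵐ x ∂volume, x ∉ Ω → u x = 0} ∧
    ∃ C : ℝ, 0 < C ∧ ∀ u ∈ halfBallEnergySpace w ν Ω,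
      (∀ᵐ x ∂volume, HasHalfBallGradAt w ν u x (halfBallGrad w ν u x)) ∧
      IsL2DistHalfBallGrad w ν u (halfBallGrad w ν u) ∧
      ∀ g, IsL2DistHalfBallGrad w ν u g →
        eLpNorm u 2 (volume.restrict Ω) ≤ ENNReal.ofReal C * eLpNorm g 2 volume := by
  have hgrad {u : EuclideanSpace ℝ (Fin d) → ℝ} (hu : MemLp u 2 volume) :
      IsL2DistHalfBallGrad w ν u (halfBallGrad w ν u) :=
    isL2DistHalfBallGrad_halfBallGrad hw.nonneg hw.radial hw_int hu
  refine ⟨Set.ext fun u => ⟨fun h => ⟨h.1, h.2.1⟩, fun h => ⟨h.1, h.2, _, hgrad h.1⟩⟩, ?_⟩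
  obtain ⟨C, hC, hP⟩ := exists_eLpNorm_le_halfBallGrad hw hw_int hΩ_bdd hν
  refine ⟨C, hC, fun u hu => ⟨?_, hgrad hu.1, fun g hg => ?_⟩⟩
  · filter_upwards [ae_hasHalfBallGradAt (ν := ν) hw.nonneg hw_int hu.1,
      halfBallGrad_ae_eq (ν := ν) hw.nonneg hw_int hu.1] with x hx hx'
    rwa [hx']
  · rw [eLpNorm_congr_ae (hg.ae_eq (hgrad hu.1))]
    exact (eLpNorm_mono_measure u Measure.restrict_le_self).trans (hP u hu.1 hu.2.1)
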